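/- Notation. Let $d\ge 1$, $\mathcal X=[0,1]^d$ (so $|\mathcal X|=1$). The responses satisfy $y=f^*(x)+\varepsilon$ with noise standard deviation function $\sigma:\mathcal X\to[0,\infty)$. Put $\bar\sigma=\int_{\mathcal X}\sigma(x)\,dx/|\mathcal X|$ and $p_X^*(x)=\sigma(x)/\int_{\mathcal X}\sigma(z)\,dz$ (the oracle sampling density). Assumptions. (i) $|f^*(x)-f^*(x')|\le\theta_1^*\|x-x'\|_2^{\theta_2^*}$ on $\mathcal X$, with $\theta_1^*\ge 0$, $0<\theta_2^*\le 1$. (ii) Given the covariates, the noises are independent, and at a covariate $x$ the noise is sub-Gaussian with mean $0$ and variance $\sigma^2(x)\le\sigma_{\max}^2$, $\sigma_{\max}>0$; moreover $|\sigma(x)-\sigma(x')|\le\theta_1^{(\sigma)}\|x-x'\|_2^{\theta_2^{(\sigma)}}$ on $\mathcal X$, with $\theta_1^{(\sigma)}\ge0$, $\theta_2^{(\sigma)}>0$. (iii) The unlabeled covariates $x_1^{(u)},\dots,x_N^{(u)}$ are i.i.d. with a density $q_X\le B$ on $\mathcal X$, $p_X^*(x)/q_X(x)=\exp(x^\top\beta)$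 on $\mathcal X$ (that is, $p^*_X(x)=q_X(x)\exp(x^\top\beta)$) for some $\|\beta\|_2\le B$, and the covariance matrix of $x^{(u)}_i$ has smallest eigenvalue at least $\lambda_0>0$. Retrieval scheme, with budget $n\ge2$ and $N\ge n$. Fix $\gamma\in(0,1)$ and let $n_0=\lfloor\gamma n\rfloor$. Step 1: draw $n_0$ of the unlabeled points uniformly without replacement, call them $x_1,\dots,x_{n_0}$, and observe their labels $y_i$. With $h_\sigma=n^{-1/(d+2)}$, $K_i(x)=\max\{0,h_\sigma-\|x_i-x\|_\infty\}$ and sums over $1\le i\le \lfloor n_0/2\rfloor$, put $$\hat\sigma^2(x)=\frac{\sum_i y_i^2K_i(x)}{1\vee\sum_iK_i(x)}-\frac{\{\sum_i y_iK_i(x)\}^2}{1\vee\{\sum_iK_i(x)\}^2}.$$ Step 2: draw $\check x_1,\dots,\check x_{N-n_0}$ i.i.d. from the density $\hat\sigma/\int_{\mathcal X}\hat\sigma$ (arbitrarily if $\int_{\mathcal X}\hat\sigma=0$), and let $\hat\beta$ be the coefficient of the logistic regression without intercept with response $0$ at the $N-n_0$ unlabeled points not drawn in Step 1 and response $1$ at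 the $\check x_i$ (arbitrary if the likelihood has no maximizer). Step 3: draw $x_{n_0+1},\dots,x_n$ independently from the $N-n_0$ unlabeled points not drawn in Step 1, each point $x$ with probability proportional to $\exp(x^\top\hat\beta)$, and observe their labels. Let $n_h(x)=\sum_{i=1}^n\mathbf 1(\|x_i-x\|_\infty\le h)$, counting all $n$ retrieved covariates. Rates. Let $$r_n=\max\Big\{\sqrt{\sigma_{\max}\theta_1^{(\sigma)}h^{\theta_2^{(\sigma)}}},\ \frac{\sigma_{\max}\log n}{nh^d}\Big\},\qquad \tilde r_n=r_n+\log n\cdot n^{-\frac{\min(2\theta_2^*,\theta_2^{(\sigma)},1/2)}{4+2d}},$$ and $\mathcal X_1=\{x\in\mathcal X:\sigma(x)\le c_r\tilde r_n\}$. Claim. Fix $d$, $\gamma$, $B$, $\lambda_0$, $\sigma_{\max}$, the sub-Gaussian variance proxy, $\theta_2^*$, $\theta_2^{(\sigma)}$, $c_0\ge0$ and $c\in(0,1)$. For every sufficiently large constant $c_r$ there is a constant $C>0$ such that for all $n\ge 2$, all $N\ge n$, and all $\theta_1^*,\theta_1^{(\sigma)}\ge 0$, $f^*,\sigma,q_X,\beta$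 and noise laws as in (i)-(iii): if $h=n^{-c_0}$ and $$|\mathcal X_1|\le c\,\min\Big\{\frac{\bar\sigma^2}{\tilde r_n^2\,n h^d},\ \frac1{\sqrt{\log n}}\Big\},$$ then $$\int_{\mathcal X}\mathbb E\Big[\frac{\sigma^2(x)+\theta_1^{(\sigma)}h^{\theta_2^{(\sigma)}}}{\max\{1,n_h(x)\}}\Big]dx\le C\,\frac{\bar\sigma^2}{nh^d}.$$ -/

import Mathlib

open MeasureTheory ProbabilityTheory
open scoped NNReal ENNReal

noncomputable section

namespace Retrieval

/-- Covariate space `ℝ^d` with its Euclidean norm. -/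
abbrev Cov (d : ℕ) : Type := EuclideanSpace ℝ (Fin d)

/-- The target region `[0,1]^d`. -/
def cube (d : ℕ) : Set (Cov d) := {x | ∀ j, 0 ≤ x j ∧ x j ≤ 1}

/-- The sup-norm distance `‖x - x'‖_∞`. -/
def supDist {d : ℕ} (x x' : Cov d) : ℝ := ‖WithLp.ofLp x - WithLp.ofLp x'‖

/-- `f ∈ H(θ₁, θ₂)` on `[0,1]^d`: the Hölder inequality for the Euclidean norm. -/
def HolderOnCube {d : ℕ} (θ₁ θ₂ : ℝ) (f : Cov d → ℝ) : Prop :=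
  ∀ x ∈ cube d, ∀ x' ∈ cube d, |f x - f x'| ≤ θ₁ * ‖x - x'‖ ^ θ₂

/-! ### The model: regression function, noise, unlabeled covariates -/

/-- Global smoothness of the regression function. -/
def SmoothRegression {d : ℕ} (θ₁ θ₂ : ℝ) (f : Cov d → ℝ) : Prop :=
  0 ≤ θ₁ ∧ HolderOnCube θ₁ θ₂ f

/-- Heteroskedastic sub-Gaussian noise. `Q x` is the conditional law of the noise at the covariate
`x`; it has mean zero, variance `σ(x)²` and sub-Gaussian variance proxy `κ`. -/
structure NoiseCondition {d : ℕ} (σmax θ₁ θ₂ : ℝ) (κ : ℝ≥0) (σ : Cov d → ℝ)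
    (Q : Kernel (Cov d) ℝ) : Prop where
  sigma_nonneg : ∀ x ∈ cube d, 0 ≤ σ x
  sigma_le : ∀ x ∈ cube d, σ x ^ 2 ≤ σmax ^ 2
  theta_nonneg : 0 ≤ θ₁
  holder : HolderOnCube θ₁ θ₂ σ
  subGaussian : ∀ x ∈ cube d, HasSubgaussianMGF (fun e : ℝ => e) κ (Q x)
  mean_zero : ∀ x ∈ cube d, ∫ e, e ∂(Q x) = 0
  variance_eq : ∀ x ∈ cube d, Var[fun e : ℝ => e; Q x] = σ x ^ 2

/-- The probability law on `[0,1]^d` with density `q`. -/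
def densityLaw {d : ℕ} (q : Cov d → ℝ) : Measure (Cov d) :=
  (volume.restrict (cube d)).withDensity fun x => ENNReal.ofReal (q x)

/-- The covariance matrix of a random vector with law `μ`. -/
def covMatrix {d : ℕ} (μ : Measure (Cov d)) : Matrix (Fin d) (Fin d) ℝ :=
  Matrix.of fun j k => cov[fun x : Cov d => x j, fun x : Cov d => x k; μ]

/-- The oracle density `p*(x) = σ(x) / ∫ σ`. -/
def oracleDensity {d : ℕ} (σ : Cov d → ℝ) (x : Cov d) : ℝ :=
  σ x / ∫ z in cube d, σ z

/-- Conditions on the density `q` of the unlabeled covariates: it is a probability density on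
`[0,1]^d` bounded by `B`, the density ratio `p*/q` is `exp(xᵀβ)` with `‖β‖₂ ≤ B`, and all
eigenvalues of the covariance matrix are at least `lam₀`. -/
structure DensityRatioCondition {d : ℕ} (B lam₀ : ℝ) (σ q : Cov d → ℝ) (β : Cov d) : Prop where
  measurable : Measurable q
  nonneg : ∀ x ∈ cube d, 0 ≤ q x
  integral_eq_one : ∫ x in cube d, q x = 1
  bounded : ∀ x ∈ cube d, q x ≤ B
  ratio : ∀ x ∈ cube d, oracleDensity σ x = q x * Real.exp (inner ℝ x β)
  norm_le : ‖β‖ ≤ B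
  eigenvalue_ge : ∀ t : ℝ,
    Module.End.HasEigenvalue (Matrix.toLin' (covMatrix (densityLaw q))) t → lam₀ ≤ t

/-! ### The estimators computed by the retrieval scheme -/

/-- Number `n₀` of pilot samples, the fraction `γ` of the budget `n` (rounded down). -/
def pilotSize (γ : ℝ) (n : ℕ) : ℕ := ⌊γ * n⌋₊

/-- The kernel `K_h(x, x') = max(0, h - ‖x - x'‖_∞)`. -/
def kern {d : ℕ} (h : ℝ) (x x' : Cov d) : ℝ := max 0 (h - supDist x x')

/-- The bandwidth `h_σ = n^{-1/(d+2)}` of the variance estimator. -/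
def varBandwidth (d n : ℕ) : ℝ := (n : ℝ) ^ (-(1 : ℝ) / ((d : ℝ) + 2))

/-- The kernel estimator of `σ²(x)`, from the first half of the `n₀` pilot samples. -/
def hatVar {d n₀ : ℕ} (n : ℕ) (xs : Fin n₀ → Cov d) (ys : Fin n₀ → ℝ) (x : Cov d) : ℝ :=
  let half : Finset (Fin n₀) := Finset.univ.filter fun i => (i : ℕ) < n₀ / 2
  let w : Fin n₀ → ℝ := fun i => kern (varBandwidth d n) (xs i) x
  (∑ i ∈ half, ys i ^ 2 * w i) / max 1 (∑ i ∈ half, w i)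
    - (∑ i ∈ half, ys i * w i) ^ 2 / max 1 ((∑ i ∈ half, w i) ^ 2)

/-- The estimated standard deviation. -/
def hatSigma {d n₀ : ℕ} (n : ℕ) (xs : Fin n₀ → Cov d) (ys : Fin n₀ → ℝ) (x : Cov d) : ℝ :=
  Real.sqrt (hatVar n xs ys x)

/-- The loss (negative log-likelihood) of logistic regression without intercept, with responses `0`
at the points `u i`, `i ∈ s`, and responses `1` at the points `v k`. -/
def logisticLoss {d N M : ℕ} (s : Finset (Fin N)) (u : Fin N → Cov d) (v : Fin M → Cov d)
    (b : Cov d) : ℝ :=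
  ∑ i ∈ s, Real.log (1 + Real.exp (inner ℝ (u i) b))
    + ∑ k, Real.log (1 + Real.exp (-inner ℝ (v k) b))

/-- The law on indices which selects `i ∈ s` with probability
`r̂(u i) / ∑_{l ∈ s} r̂(u l)`, where `r̂(x) = exp(xᵀb)`. -/
def weightLaw {d N : ℕ} (s : Finset (Fin N)) (u : Fin N → Cov d) (b : Cov d) :
    Measure (Fin N) :=
  ∑ i ∈ s, ENNReal.ofReal
    (Real.exp (inner ℝ (u i) b) / ∑ l ∈ s, Real.exp (inner ℝ (u l) b)) • Measure.dirac i

/-- The indices of the unlabeled points that were not selected for the pilot sample. -/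
def remaining {n₀ N : ℕ} (idx : Fin n₀ → Fin N) : Finset (Fin N) :=
  Finset.univ \ Finset.univ.image idx

/-! ### The random experiment -/

/-- Given the past `S`, and on the event `S ∈ G`, the variables `X i` are conditionally independent
with conditional laws `ν S i`. -/
def CondIndepGiven {Ω 𝓢 E : Type*} [MeasurableSpace Ω] [MeasurableSpace 𝓢] [MeasurableSpace E]
    (P : Measure Ω) (S : Ω → 𝓢) (G : Set 𝓢) {m : ℕ} (X : Fin m → Ω → E)
    (ν : 𝓢 → Fin m → Measure E) : Prop :=
  ∀ A : Set 𝓢, MeasurableSet A → A ⊆ G →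
    ∀ B : Fin m → Set E, (∀ i, MeasurableSet (B i)) →
      P {ω | S ω ∈ A ∧ ∀ i, X i ω ∈ B i} = ∫⁻ ω in S ⁻¹' A, ∏ i, ν (S ω) i (B i) ∂P

/-- The random quantities of one run with budget `n`, pilot size `n₀` and `N` unlabeled points. -/
structure Run (Ω : Type*) (d n n₀ N : ℕ) where
  /-- the unlabeled covariates -/
  unl : Ω → Fin N → Cov d
  /-- the indices of the pilot sample -/
  idx : Ω → Fin n₀ → Fin N
  /-- the noises of the pilot labels -/
  eps : Ω → Fin n₀ → ℝ
  /-- the synthetic covariates, drawn from the estimated oracle density -/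
  syn : Ω → Fin (N - n₀) → Cov d
  /-- the logistic regression estimate -/
  bhat : Ω → Cov d
  /-- the indices of the unlabeled points selected by weighted sampling -/
  sel : Ω → Fin (n - n₀) → Fin N
  /-- the noises of the labels of the latter points -/
  eps' : Ω → Fin (n - n₀) → ℝ

namespace Run

variable {Ω : Type*} {d n n₀ N : ℕ} (R : Run Ω d n n₀ N)

/-- The pilot covariates. -/
def pilotX (ω : Ω) (i : Fin n₀) : Cov d := R.unl ω (R.idx ω i)

/-- The covariates selected by weighted sampling. -/
def selX (ω : Ω) (k : Fin (n - n₀)) : Cov d := R.unl ω (R.sel ω k)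

/-- The `n` retrieved covariates: the `n₀` pilot ones and the `n - n₀` selected by weights. -/
def retrX (ω : Ω) : Fin n₀ ⊕ Fin (n - n₀) → Cov d := Sum.elim (R.pilotX ω) (R.selX ω)

/-- `n_h(x)`, the number of retrieved covariates (among all `n`, with multiplicity) at sup-norm
distance at most `h` from `x`. -/
def localCount (h : ℝ) (x : Cov d) (ω : Ω) : ℕ :=
  Nat.card {i : Fin n₀ ⊕ Fin (n - n₀) // supDist (R.retrX ω i) x ≤ h}

/-- Everything known after the pilot labels have been collected. -/
def pilotPast (ω : Ω) : (Fin N → Cov d) × (Fin n₀ → Fin N) × (Fin n₀ → ℝ) :=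
  (R.unl ω, R.idx ω, R.eps ω)

/-- Everything known after the logistic regression. -/
def fitPast (ω : Ω) :
    ((Fin N → Cov d) × (Fin n₀ → Fin N) × (Fin n₀ → ℝ)) × (Fin (N - n₀) → Cov d) × Cov d :=
  (R.pilotPast ω, R.syn ω, R.bhat ω)

end Run

/-- The estimated standard deviation as a function of the past (unlabeled points, pilot indices,
pilot noises); the pilot responses are `y i = f (x i) + ε i`. -/
def pastSigma {d n₀ N : ℕ} (n : ℕ) (f : Cov d → ℝ)
    (s : (Fin N → Cov d) × (Fin n₀ → Fin N) × (Fin n₀ → ℝ)) : Cov d → ℝ :=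
  hatSigma n (fun i => s.1 (s.2.1 i)) (fun i => f (s.1 (s.2.1 i)) + s.2.2 i)

/-- `R` is a run of the retrieval scheme: unlabeled covariates with density `q`, regression
function `f`, conditional noise laws `Q`. -/
structure IsRetrievalRun {Ω : Type*} [MeasurableSpace Ω] (P : Measure Ω) {d n n₀ N : ℕ}
    (f q : Cov d → ℝ) (Q : Kernel (Cov d) ℝ) (R : Run Ω d n n₀ N) : Prop where
  meas_unl : Measurable R.unl
  meas_idx : Measurable R.idx
  meas_eps : Measurable R.eps
  meas_syn : Measurable R.syn
  meas_bhat : Measurable R.bhat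
  meas_sel : Measurable R.sel
  meas_eps' : Measurable R.eps'
  /-- the unlabeled covariates are i.i.d. with density `q` -/
  unl_indep : iIndepFun (fun i ω => R.unl ω i) P
  unl_law : ∀ i, P.map (fun ω => R.unl ω i) = densityLaw q
  /-- the pilot points are drawn uniformly without replacement from the unlabeled points -/
  idx_law : P.map R.idx = uniformOn {e : Fin n₀ → Fin N | Function.Injective e}
  idx_indep : IndepFun R.idx R.unl P
  /-- the pilot labels follow the regression model -/
  eps_law : CondIndepGiven P (fun ω => (R.unl ω, R.idx ω)) Set.univ (fun i ω => R.eps ω i)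
    (fun s i => Q (s.1 (s.2 i)))
  /-- the synthetic covariates are i.i.d. with density `σ̂ / ∫ σ̂`, when this is defined -/
  syn_law : CondIndepGiven P R.pilotPast {s | 0 < ∫ x in cube d, pastSigma n f s x}
    (fun k ω => R.syn ω k) (fun s _ => densityLaw (oracleDensity (pastSigma n f s)))
  /-- `bhat` solves the logistic regression, when this has a solution -/
  bhat_min : ∀ᵐ ω ∂P,
    (∃ b, IsMinOn (logisticLoss (remaining (R.idx ω)) (R.unl ω) (R.syn ω)) Set.univ b) →
      IsMinOn (logisticLoss (remaining (R.idx ω)) (R.unl ω) (R.syn ω)) Set.univ (R.bhat ω)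
  /-- weighted sampling of the remaining unlabeled points -/
  sel_law : CondIndepGiven P R.fitPast Set.univ (fun k ω => R.sel ω k)
    (fun s _ => weightLaw (remaining s.1.2.1) s.1.1 s.2.2)
  /-- the labels of these points follow the regression model -/
  eps'_law : CondIndepGiven P (fun ω => (R.fitPast ω, R.sel ω)) Set.univ (fun k ω => R.eps' ω k)
    (fun s k => Q (s.1.1.1 (s.2 k)))

/-! ### The quantities in the bound -/

/-- The average noise level `σ̄ = (∫ σ) / |[0,1]^d|`. -/
def sigmaBar {d : ℕ} (σ : Cov d → ℝ) : ℝ :=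
  (∫ x in cube d, σ x) / (volume (cube d)).toReal

/-- `r_n = max {√(σmax θ₁ h^θ₂), σmax log n / (n h^d)}`. -/
def rate (d n : ℕ) (σmax θ₁ θ₂ h : ℝ) : ℝ :=
  max (Real.sqrt (σmax * θ₁ * h ^ θ₂)) (σmax * Real.log n / (n * h ^ d))

/-- `r̃_n = r_n + log n · n^{-min(2θ*₂, θ₂, 1/2)/(4+2d)}`. -/
def rateTilde (d n : ℕ) (σmax θ₁ θ₂ θstar₂ h : ℝ) : ℝ :=
  rate d n σmax θ₁ θ₂ h
    + Real.log n * (n : ℝ) ^ (-(min (min (2 * θstar₂) θ₂) (1 / 2)) / (4 + 2 * (d : ℝ)))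

/-- The low-noise region `{x ∈ [0,1]^d : σ(x) ≤ t}`. -/
def lowNoise {d : ℕ} (σ : Cov d → ℝ) (t : ℝ) : Set (Cov d) := {x ∈ cube d | σ x ≤ t}

end Retrieval

end

namespace Retrieval

/-! The pilot points alone give the bound: the adaptively selected points can only increase
`n_h(x)`, so neither `σ̂` nor the logistic fit has to be analysed. Pilot points are i.i.d. from `q`,
and Chebyshev bounds the mean inverse count in a window of `q`-mass `p` by a multiple of `1 / (n p)`
(`lintegral_inv_count_le`, `lintegral_inv_localCount_le_budget`).

Write `I = ∫ σ` and `r = r̃_n`. Where `σ(x) > cr * r`, Hölder continuity keeps `σ ≥ σ(x) / 2` on the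
window (`half_le_of_supDist_le`). As `q` is comparable to `σ / I`, this gives `p ≳ σ(x) h^d / I`
(`le_measureReal_window`). The numerator is `≲ σ(x)²`, so the risk is `≲ σ(x) I / (n h^d)`, which
integrates to `I² / (n h^d)`.

Where `σ(x) ≤ cr * r`, the inverse count is at most `1` and the numerator is `≲ r²`; the assumed
volume bound on this region absorbs `r²`. -/

/-! ### Inverse moments of binomial counts. -/

/-- The inverse of a binomial count is at most of the order of the inverse mean. -/
lemma lintegral_inv_count_le {Ω E ι : Type*} [MeasurableSpace Ω] [MeasurableSpace E] [Fintype ι]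
    {P : Measure Ω} [IsProbabilityMeasure P] {X : ι → Ω → E} (hX : ∀ i, Measurable (X i))
    (hind : iIndepFun X P) {μ : Measure E} (hlaw : ∀ i, P.map (X i) = μ) {A : Set E}
    (hA : MeasurableSet A) (hp : 0 < μ.real A) (hm : 0 < Fintype.card ι) :
    ∫⁻ ω, ENNReal.ofReal (1 / max 1 (Nat.card {i // X i ω ∈ A} : ℝ)) ∂P
      ≤ ENNReal.ofReal (6 / (Fintype.card ι * μ.real A)) := by
  classical
  set p : ℝ := μ.real A with hp_def
  set m : ℝ := (Fintype.card ι : ℝ) with hm_def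
  have hm0 : 0 < m := Nat.cast_pos.2 hm
  have hφ : Measurable (A.indicator (fun _ => (1 : ℝ))) := measurable_const.indicator hA
  let Z : ι → Ω → ℝ := fun i ω => A.indicator (fun _ => (1 : ℝ)) (X i ω)
  have hZm : ∀ i, Measurable (Z i) := fun i => hφ.comp (hX i)
  have hZ01 : ∀ i ω, Z i ω = 0 ∨ Z i ω = 1 := fun i ω => by
    by_cases hx : X i ω ∈ A <;> simp [Z, hx]
  have hZL : ∀ i, MemLp (Z i) 2 P := fun i =>
    MemLp.of_bound (hZm i).aestronglyMeasurable 1 (ae_of_all _ fun ω => by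
      rcases hZ01 i ω with h | h <;> simp [h])
  have hZint : ∀ i, ∫ ω, Z i ω ∂P = p := fun i => by
    have : ∫ ω, Z i ω ∂P = ∫ x, A.indicator (fun _ => (1 : ℝ)) x ∂(P.map (X i)) :=
      (integral_map (hX i).aemeasurable hφ.aestronglyMeasurable).symm
    rw [this, hlaw i, integral_indicator hA]
    simp [hp_def]
  have hZvar : ∀ i, Var[Z i; P] ≤ p := fun i => by
    refine (variance_le_expectation_sq (hZm i).aestronglyMeasurable).trans_eq ?_
    rw [← hZint i]
    refine integral_congr_ae (ae_of_all _ fun ω => ?_)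
    rcases hZ01 i ω with h | h <;> simp [h]
  let S : Ω → ℝ := ∑ i, Z i
  have hSL : MemLp S 2 P := memLp_finsetSum' _ fun i _ => hZL i
  have hSint : ∫ ω, S ω ∂P = m * p := by
    simp only [S, Finset.sum_apply]
    rw [integral_finsetSum _ fun i _ => (hZL i).integrable (by norm_num)]
    simp [hZint, hm_def]
  have hSvar : Var[S; P] ≤ m * p := by
    rw [IndepFun.variance_sum (fun i _ => hZL i) fun i _ j _ hij =>
      (hind.indepFun hij).comp hφ hφ]
    refine (Finset.sum_le_sum fun i _ => hZvar i).trans_eq ?_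
    simp [hm_def]
  have hcount : ∀ ω, (Nat.card {i // X i ω ∈ A} : ℝ) = S ω := fun ω => by
    simp only [S, Z, Finset.sum_apply, Set.indicator_apply, Finset.sum_boole]
    rw [Nat.card_eq_fintype_card, Fintype.card_subtype]
  have hmp : 0 < m * p := mul_pos hm0 hp
  have hsq : Integrable (fun ω => (S ω - m * p) ^ 2) P :=
    (hSL.sub (memLp_const (m * p))).integrable_sq
  -- Chebyshev in pointwise form: the first term covers `S ≥ m p / 2`; otherwise the deviation
  -- exceeds `m p / 2` and the second term is at least `1`. Since `Var S ≤ m p`, the mean is at most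
  -- `(2 + 4) / (m p)`.
  have hpt : ∀ ω, 1 / max 1 (Nat.card {i // X i ω ∈ A} : ℝ)
      ≤ 2 / (m * p) + 4 / (m * p) ^ 2 * (S ω - m * p) ^ 2 := fun ω => by
    rw [hcount]
    by_cases hS : m * p / 2 ≤ S ω
    · have h1 : 1 / max 1 (S ω) ≤ 1 / (m * p / 2) :=
        one_div_le_one_div_of_le (by positivity) (hS.trans (le_max_right _ _))
      have h2 : 1 / (m * p / 2) = 2 / (m * p) := by field_simp
      have h3 : 0 ≤ 4 / (m * p) ^ 2 * (S ω - m * p) ^ 2 := by positivity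
      linarith
    · have h1 : 1 / max 1 (S ω) ≤ 1 := by
        rw [div_le_one (by positivity)]; exact le_max_left _ _
      have h2 : (m * p / 2) ^ 2 ≤ (S ω - m * p) ^ 2 := by nlinarith
      have h3 : 1 ≤ 4 / (m * p) ^ 2 * (S ω - m * p) ^ 2 := by
        rw [div_mul_eq_mul_div, le_div_iff₀ (by positivity)]; nlinarith
      have h4 : 0 ≤ 2 / (m * p) := by positivity
      linarith
  refine (lintegral_mono fun ω => ENNReal.ofReal_le_ofReal (hpt ω)).trans ?_
  rw [← ofReal_integral_eq_lintegral_ofReal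
    (f := fun ω => 2 / (m * p) + 4 / (m * p) ^ 2 * (S ω - m * p) ^ 2)
    ((integrable_const _).add (hsq.const_mul _)) (ae_of_all _ fun ω => by positivity)]
  refine ENNReal.ofReal_le_ofReal ?_
  have hvar : ∫ ω, (S ω - m * p) ^ 2 ∂P ≤ m * p := by
    rw [← hSint, ← variance_eq_integral hSL.aestronglyMeasurable.aemeasurable, hSint]
    exact hSvar
  rw [integral_add (integrable_const _) (hsq.const_mul _), integral_const_mul]
  have h5 : 4 / (m * p) ^ 2 * ∫ ω, (S ω - m * p) ^ 2 ∂P ≤ 4 / (m * p) ^ 2 * (m * p) := by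
    gcongr
  have h6 : 4 / (m * p) ^ 2 * (m * p) = 4 / (m * p) := by field_simp
  have h7 : (6 : ℝ) / (m * p) = 2 / (m * p) + 4 / (m * p) := by ring
  simp only [integral_const, probReal_univ, smul_eq_mul, one_mul]
  linarith

/-! ### Geometry of the cube and sup-norm windows. -/

variable {d : ℕ}

lemma measurable_supDist_left (x : Cov d) : Measurable fun x' => supDist x' x := by
  unfold supDist
  fun_prop

lemma measurableSet_supBall (h : ℝ) (x : Cov d) : MeasurableSet {x' | supDist x' x ≤ h} :=
  measurableSet_le (measurable_supDist_left x) measurable_const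

lemma supDist_le_iff {x x' : Cov d} {h : ℝ} (hh : 0 ≤ h) :
    supDist x x' ≤ h ↔ ∀ j, |x j - x' j| ≤ h := by
  simp [supDist, pi_norm_le_iff_of_nonneg hh]

lemma norm_le_sqrt_mul {x : Cov d} {h : ℝ} (hh : 0 ≤ h) (hx : ∀ j, |x j| ≤ h) :
    ‖x‖ ≤ √d * h := by
  rw [EuclideanSpace.norm_eq]
  refine (Real.sqrt_le_sqrt (Finset.sum_le_sum fun j _ =>
    pow_le_pow_left₀ (norm_nonneg _) (hx j) 2)).trans_eq ?_
  simp [Real.sqrt_mul, Real.sqrt_sq hh]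

lemma cube_eq_preimage (a b : Fin d → ℝ) :
    {x : Cov d | ∀ j, a j ≤ x j ∧ x j ≤ b j}
      = (MeasurableEquiv.toLp 2 (Fin d → ℝ)).symm ⁻¹' Set.Icc a b := by
  ext x
  simp [Set.mem_Icc, Pi.le_def, forall_and]

lemma volume_box (a b : Fin d → ℝ) :
    volume {x : Cov d | ∀ j, a j ≤ x j ∧ x j ≤ b j} = ∏ j, ENNReal.ofReal (b j - a j) := by
  rw [cube_eq_preimage, (EuclideanSpace.volume_preserving_symm_measurableEquiv_toLp
    (Fin d)).measure_preimage_equiv, Real.volume_Icc_pi]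

lemma volume_cube : volume (cube d) = 1 := by
  have := volume_box (d := d) 0 1
  simpa [cube] using this

lemma isCompact_cube : IsCompact (cube d) := by
  have h : cube d = (EuclideanSpace.equiv (Fin d) ℝ).toHomeomorph ⁻¹' Set.Icc 0 1 := by
    ext x
    simp [cube, Set.mem_Icc, Pi.le_def, forall_and]
  rw [h]
  exact (Homeomorph.isCompact_preimage _).2 isCompact_Icc

lemma measurableSet_cube : MeasurableSet (cube d) := isCompact_cube.isClosed.measurableSet

lemma HolderOnCube.continuousOn {θ₁ θ₂ : ℝ} {f : Cov d → ℝ} (hf : HolderOnCube θ₁ θ₂ f)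
    (hθ₂ : 0 < θ₂) : ContinuousOn f (cube d) := by
  intro x hx
  rw [ContinuousWithinAt, tendsto_iff_dist_tendsto_zero]
  have hlim : Filter.Tendsto (fun x' => θ₁ * ‖x' - x‖ ^ θ₂) (nhdsWithin x (cube d)) (nhds 0) := by
    have : ContinuousAt (fun x' : Cov d => θ₁ * ‖x' - x‖ ^ θ₂) x :=
      continuousAt_const.mul (ContinuousAt.rpow_const (by fun_prop) (Or.inr hθ₂.le))
    have h0 := this.tendsto
    simp only [sub_self, norm_zero, Real.zero_rpow hθ₂.ne', mul_zero] at h0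
    exact h0.mono_left nhdsWithin_le_nhds
  refine squeeze_zero' (Filter.Eventually.of_forall fun _ => dist_nonneg) ?_ hlim
  filter_upwards [self_mem_nhdsWithin] with x' hx'
  exact hf x' hx' x hx

/-! ### Local counts of the pilot sample. -/

lemma measurable_inv_count {E : Type*} [MeasurableSpace E] {A : Set E} (hA : MeasurableSet A)
    {n₀ N : ℕ} : Measurable fun s : (Fin n₀ → Fin N) × (Fin N → E) =>
      ENNReal.ofReal (1 / max 1 (Nat.card {i // s.2 (s.1 i) ∈ A} : ℝ)) := by
  classical
  refine measurable_from_prod_countable_right fun e => ?_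
  have h : ∀ u : Fin N → E, (Nat.card {i // u (e i) ∈ A} : ℝ)
      = ∑ i, A.indicator (fun _ => (1 : ℝ)) (u (e i)) := fun u => by
    simp only [Set.indicator_apply, Finset.sum_boole]
    rw [Nat.card_eq_fintype_card, Fintype.card_subtype]
  simp only [h]
  have hφ : Measurable (A.indicator (fun _ => (1 : ℝ))) := measurable_const.indicator hA
  have hs : Measurable fun u : Fin N → E => ∑ i, A.indicator (fun _ => (1 : ℝ)) (u (e i)) :=
    Finset.measurable_sum _ fun i _ => hφ.comp (measurable_pi_apply (e i))
  exact (measurable_const.div (measurable_const.max hs)).ennreal_ofReal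

/-- Discards the weighted selections, whose law depends on the pilot data. -/
lemma card_pilot_le_localCount {Ω : Type*} {n n₀ N : ℕ} (R : Run Ω d n n₀ N) (h : ℝ) (x : Cov d)
    (ω : Ω) :
    Nat.card {i // R.unl ω (R.idx ω i) ∈ {x' | supDist x' x ≤ h}} ≤ R.localCount h x ω :=
  Nat.card_le_card_of_injective
    (fun i => (⟨Sum.inl i.1, i.2⟩ : {i // supDist (R.retrX ω i) x ≤ h}))
    fun _ _ hij => Subtype.ext (Sum.inl_injective (congrArg Subtype.val hij))

/-- Sampling without replacement from an i.i.d. family, independently of its values, gives again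
an i.i.d. family, to which the bound on inverse counts applies. -/
lemma lintegral_inv_count_subsample_le {Ω E : Type*} [MeasurableSpace Ω] [MeasurableSpace E]
    {P : Measure Ω} [IsProbabilityMeasure P] {n₀ N : ℕ} {u : Ω → Fin N → E}
    {idx : Ω → Fin n₀ → Fin N} (hu : Measurable u) (hidx : Measurable idx)
    (huind : iIndepFun (fun i ω => u ω i) P) {μ : Measure E}
    (hlaw : ∀ i, P.map (fun ω => u ω i) = μ) (hind : IndepFun idx u P)
    (hinj : ∀ᵐ e ∂(P.map idx), Function.Injective e) {A : Set E} (hA : MeasurableSet A)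
    (hp : 0 < μ.real A) (hn₀ : 0 < n₀) :
    ∫⁻ ω, ENNReal.ofReal (1 / max 1 (Nat.card {i // u ω (idx ω i) ∈ A} : ℝ)) ∂P
      ≤ ENNReal.ofReal (6 / (n₀ * μ.real A)) := by
  have hprob : IsProbabilityMeasure (P.map idx) :=
    Measure.isProbabilityMeasure_map hidx.aemeasurable
  have hprob' : IsProbabilityMeasure (P.map u) :=
    Measure.isProbabilityMeasure_map hu.aemeasurable
  let F : (Fin n₀ → Fin N) × (Fin N → E) → ℝ≥0∞ := fun s =>
    ENNReal.ofReal (1 / max 1 (Nat.card {i // s.2 (s.1 i) ∈ A} : ℝ))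
  have hF : Measurable F := measurable_inv_count hA
  -- Independence of `idx` and `u` allows freezing the indices at `e`; an injective `e` selects
  -- distinct members of the family, which are again i.i.d.
  have hinner : ∀ e : Fin n₀ → Fin N, Function.Injective e →
      ∫⁻ v, F (e, v) ∂(P.map u) ≤ ENNReal.ofReal (6 / (n₀ * μ.real A)) := fun e he => by
    have hFe : Measurable fun v => F (e, v) := hF.comp measurable_prodMk_left
    have hcount := lintegral_inv_count_le (fun i => (measurable_pi_apply (e i)).comp hu)
      (huind.precomp he) (fun i => hlaw (e i)) hA hp (by simpa using hn₀)
    rw [Fintype.card_fin] at hcount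
    rw [lintegral_map hFe hu]
    exact hcount
  calc ∫⁻ ω, F (idx ω, u ω) ∂P
      = ∫⁻ s, F s ∂(P.map fun ω => (idx ω, u ω)) := (lintegral_map hF (hidx.prodMk hu)).symm
    _ = ∫⁻ e, ∫⁻ v, F (e, v) ∂(P.map u) ∂(P.map idx) := by
        rw [(indepFun_iff_map_prod_eq_prod_map_map hidx.aemeasurable hu.aemeasurable).1 hind,
          lintegral_prod _ hF.aemeasurable]
    _ ≤ ∫⁻ _, ENNReal.ofReal (6 / (n₀ * μ.real A)) ∂(P.map idx) :=
        lintegral_mono_ae (hinj.mono hinner)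
    _ = _ := by simp

/-- The pilot points form an i.i.d. sample from the unlabeled law, so they alone keep the
expected inverse local count small. -/
lemma IsRetrievalRun.lintegral_inv_localCount_le {Ω : Type*} [MeasurableSpace Ω] {P : Measure Ω}
    [IsProbabilityMeasure P] {n n₀ N : ℕ} {f q : Cov d → ℝ} {Q : Kernel (Cov d) ℝ}
    {R : Run Ω d n n₀ N} (hR : IsRetrievalRun P f q Q R) (h : ℝ) (x : Cov d) (hn₀ : 0 < n₀)
    (hp : 0 < (densityLaw q).real {x' | supDist x' x ≤ h}) :
    ∫⁻ ω, ENNReal.ofReal (1 / max 1 (R.localCount h x ω : ℝ)) ∂P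
      ≤ ENNReal.ofReal (6 / (n₀ * (densityLaw q).real {x' | supDist x' x ≤ h})) := by
  have hinj : ∀ᵐ e ∂(P.map R.idx), Function.Injective e := by
    rw [hR.idx_law]
    exact ae_cond_mem (Set.toFinite _).measurableSet
  refine (lintegral_mono fun ω => ENNReal.ofReal_le_ofReal ?_).trans
    (lintegral_inv_count_subsample_le hR.meas_unl hR.meas_idx hR.unl_indep hR.unl_law
      hR.idx_indep hinj (measurableSet_supBall h x) hp hn₀)
  exact one_div_le_one_div_of_le (by positivity)
    (max_le_max_left _ (Nat.cast_le.2 (card_pilot_le_localCount R h x ω)))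

/-- The truncation at `1` gives this fallback for the low-noise region and for an empty pilot
sample. -/
lemma lintegral_inv_localCount_le_one {Ω : Type*} [MeasurableSpace Ω] {P : Measure Ω}
    [IsProbabilityMeasure P] {n n₀ N : ℕ} (R : Run Ω d n n₀ N) (h : ℝ) (x : Cov d) :
    ∫⁻ ω, ENNReal.ofReal (1 / max 1 (R.localCount h x ω : ℝ)) ∂P ≤ 1 := by
  refine (lintegral_mono fun ω => ?_).trans_eq (lintegral_one.trans measure_univ)
  rw [ENNReal.ofReal_le_one]
  exact div_le_one_of_le₀ (le_max_left _ _) (by positivity)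

/-- The case of an arbitrary pilot size, in terms of the budget and a lower bound on the
probability of the local window. -/
lemma IsRetrievalRun.lintegral_inv_localCount_le_budget {Ω : Type*} [MeasurableSpace Ω]
    {P : Measure Ω} [IsProbabilityMeasure P] {γ : ℝ} {n N : ℕ} {f q : Cov d → ℝ}
    {Q : Kernel (Cov d) ℝ} {R : Run Ω d n (pilotSize γ n) N} (hR : IsRetrievalRun P f q Q R)
    (hγ : 0 < γ) (hn : 0 < n) (h : ℝ) (x : Cov d) {p : ℝ} (hp : 0 < p) (hp1 : p ≤ 1)
    (hpA : p ≤ (densityLaw q).real {x' | supDist x' x ≤ h}) :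
    ∫⁻ ω, ENNReal.ofReal (1 / max 1 (R.localCount h x ω : ℝ)) ∂P
      ≤ ENNReal.ofReal (12 / (γ * n * p)) := by
  have hn' : (0 : ℝ) < n := Nat.cast_pos.2 hn
  have hlt : γ * n < pilotSize γ n + 1 := Nat.lt_floor_add_one _
  rcases Nat.eq_zero_or_pos (pilotSize γ n) with h0 | h0
  -- An empty pilot sample forces `γ n < 1`, so the right side already exceeds `1`.
  · refine (lintegral_inv_localCount_le_one R h x).trans ?_
    rw [ENNReal.one_le_ofReal, one_le_div (by positivity)]
    rw [h0] at hlt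
    have : γ * n * p ≤ 1 * 1 := by gcongr; simpa using hlt.le
    linarith
  · refine (hR.lintegral_inv_localCount_le h x h0 (hp.trans_le hpA)).trans
      (ENNReal.ofReal_le_ofReal ?_)
    have h1 : (1 : ℝ) ≤ pilotSize γ n := by exact_mod_cast h0
    have hA0 := hp.trans_le hpA
    rw [div_le_div_iff₀ (by positivity) (by positivity)]
    -- Rounding down loses at most a factor `2` once `n₀ ≥ 1`, turning `6` into `12`.
    have h2 : γ * n ≤ 2 * pilotSize γ n := by linarith
    have : γ * n * p ≤ 2 * pilotSize γ n * (densityLaw q).real {x' | supDist x' x ≤ h} := by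
      gcongr
    linarith

/-! ### Mass of a window under the unlabeled law. -/

lemma abs_inner_le_of_mem_cube {x β : Cov d} {B : ℝ} (hx : x ∈ cube d) (hβ : ‖β‖ ≤ B) :
    |inner ℝ x β| ≤ √d * B := by
  have h1 : ‖x‖ ≤ √d * 1 := norm_le_sqrt_mul zero_le_one fun j => by
    rw [abs_of_nonneg (hx j).1]; exact (hx j).2
  refine (abs_real_inner_le_norm x β).trans ?_
  have := norm_nonneg β
  gcongr
  linarith

/-- In the cube, a window of radius `h ≤ 1` around a point has volume at least `h ^ d`. -/
lemma ofReal_pow_le_volume_window {x : Cov d} (hx : x ∈ cube d) {h : ℝ} (hh : 0 ≤ h)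
    (hh1 : h ≤ 1) :
    -- The cube contracted towards `x` by the factor `h` is a box of side `h` inside both the cube
    -- and the window, even when `x` is on the boundary.
    ENNReal.ofReal (h ^ d) ≤ volume ({x' | supDist x' x ≤ h} ∩ cube d) := by
  have hbox := volume_box (fun j => (1 - h) * x j) (fun j => (1 - h) * x j + h)
  simp only [add_sub_cancel_left, Finset.prod_const, Finset.card_univ, Fintype.card_fin] at hbox
  rw [ENNReal.ofReal_pow hh, ← hbox]
  refine measure_mono fun y hy => ⟨(supDist_le_iff hh).2 fun j => ?_, fun j => ?_⟩
  · have h1 := mul_nonneg hh (hx j).1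
    have h2 := mul_le_mul_of_nonneg_left (hx j).2 hh
    have := hy j
    rw [abs_le]
    constructor <;> linarith [this.1, this.2]
  · have h1 := mul_nonneg (sub_nonneg.2 hh1) (hx j).1
    have h2 := mul_le_mul_of_nonneg_left (hx j).2 (sub_nonneg.2 hh1)
    have := hy j
    constructor <;> linarith [this.1, this.2]

lemma DensityRatioCondition.isProbabilityMeasure {B lam₀ : ℝ} {σ q : Cov d → ℝ} {β : Cov d}
    (hq : DensityRatioCondition B lam₀ σ q β) : IsProbabilityMeasure (densityLaw q) := by
  refine ⟨?_⟩
  -- A non-integrable `q` would have Bochner integral `0`, not `1`.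
  have hint : IntegrableOn q (cube d) := by
    by_contra hcon
    have := hq.integral_eq_one
    rw [integral_undef hcon] at this
    exact zero_ne_one this
  rw [densityLaw, withDensity_apply _ MeasurableSet.univ, Measure.restrict_univ,
    ← ofReal_integral_eq_lintegral_ofReal hint
      ((ae_restrict_iff' measurableSet_cube).2 (ae_of_all _ hq.nonneg)),
    hq.integral_eq_one, ENNReal.ofReal_one]

/-- If `∫ σ = 0`, division by zero makes the oracle density `0`; the ratio identity then forces `q =
0` on the cube, contradicting total mass `1`. -/
lemma DensityRatioCondition.integral_pos {B lam₀ : ℝ} {σ q : Cov d → ℝ} {β : Cov d}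
    (hq : DensityRatioCondition B lam₀ σ q β) (hσ : ∀ x ∈ cube d, 0 ≤ σ x) :
    0 < ∫ z in cube d, σ z := by
  refine (setIntegral_nonneg measurableSet_cube hσ).lt_of_ne fun h0 => ?_
  have hzero : ∀ x ∈ cube d, q x = 0 := fun x hx => by
    have := hq.ratio x hx
    rw [oracleDensity, ← h0, div_zero] at this
    exact (mul_eq_zero.1 this.symm).resolve_right (Real.exp_pos _).ne'
  have := hq.integral_eq_one
  rw [setIntegral_congr_fun measurableSet_cube hzero, integral_zero] at this
  exact zero_ne_one this

/-- The bounded density ratio transfers lower bounds on `σ` to the unlabeled law. -/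
lemma DensityRatioCondition.le_measureReal_window {B lam₀ : ℝ} {σ q : Cov d → ℝ} {β : Cov d}
    (hq : DensityRatioCondition B lam₀ σ q β) (hσ : ∀ x ∈ cube d, 0 ≤ σ x) {x : Cov d}
    (hx : x ∈ cube d) {h : ℝ} (hh : 0 ≤ h) (hh1 : h ≤ 1) {s : ℝ} (hs : 0 ≤ s)
    (hle : ∀ x' ∈ cube d, supDist x' x ≤ h → s ≤ σ x') :
    s * Real.exp (-(√d * B)) / (∫ z in cube d, σ z) * h ^ d
      ≤ (densityLaw q).real {x' | supDist x' x ≤ h} := by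
  have := hq.isProbabilityMeasure
  have hI := hq.integral_pos hσ
  set I := ∫ z in cube d, σ z with hI_def
  have hA := measurableSet_supBall h x
  rw [measureReal_def, ← ENNReal.ofReal_le_iff_le_toReal (measure_ne_top _ _), densityLaw,
    withDensity_apply _ hA, Measure.restrict_restrict hA,
    ENNReal.ofReal_mul (by positivity)]
  refine (mul_le_mul_right (ofReal_pow_le_volume_window hx hh hh1) _).trans ?_
  rw [← setLIntegral_const]
  refine setLIntegral_mono' (hA.inter measurableSet_cube) fun x' hx' =>
    ENNReal.ofReal_le_ofReal ?_
  have hr := hq.ratio x' hx'.2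
  -- Solving the ratio identity for `q`; Cauchy-Schwarz bounds the exponential below by `exp (-(√d *
  -- B))`.
  have hqx : q x' = σ x' / I * Real.exp (-inner ℝ x' β) := by
    rw [hI_def, ← oracleDensity, hr, mul_assoc, ← Real.exp_add]; simp
  have hin := (abs_le.1 (abs_inner_le_of_mem_cube hx'.2 hq.norm_le)).2
  rw [hqx, mul_div_right_comm]
  have hsσ := hle x' hx'.2 hx'.1
  have hσ0 : 0 ≤ σ x' / I := div_nonneg (hσ x' hx'.2) hI.le
  gcongr

lemma sigmaBar_eq (σ : Cov d → ℝ) : sigmaBar σ = ∫ x in cube d, σ x := by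
  simp [sigmaBar, volume_cube]

/-! ### The rate and the stability of `σ` on windows. -/

lemma rateTilde_pos {n : ℕ} (hn : 2 ≤ n) {σmax θ₁ θ₂ θstar₂ h : ℝ} :
    0 < rateTilde d n σmax θ₁ θ₂ θstar₂ h := by
  have hlog : 0 < Real.log n := Real.log_pos (by exact_mod_cast hn)
  have hn' : (0 : ℝ) < n := by positivity
  have h1 : 0 ≤ rate d n σmax θ₁ θ₂ h := (Real.sqrt_nonneg _).trans (le_max_left _ _)
  have h2 := Real.rpow_pos_of_pos hn' (-(min (min (2 * θstar₂) θ₂) (1 / 2)) / (4 + 2 * (d : ℝ)))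
  unfold rateTilde
  positivity

/-- The rate dominates the smoothing bias of `σ`. -/
lemma mul_rpow_le_rateTilde_sq {n : ℕ} (hn : 2 ≤ n) {σmax θ₁ θ₂ θstar₂ h : ℝ} :
    σmax * θ₁ * h ^ θ₂ ≤ rateTilde d n σmax θ₁ θ₂ θstar₂ h ^ 2 := by
  have hlog : 0 ≤ Real.log n := Real.log_natCast_nonneg n
  have h2 : 0 ≤ Real.log n * (n : ℝ) ^
      (-(min (min (2 * θstar₂) θ₂) (1 / 2)) / (4 + 2 * (d : ℝ))) := by positivity
  have h1 : √(σmax * θ₁ * h ^ θ₂) ≤ rateTilde d n σmax θ₁ θ₂ θstar₂ h :=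
    (le_max_left _ _).trans (le_add_of_nonneg_right h2)
  exact (Real.sqrt_le_left (rateTilde_pos hn).le).1 h1

/-- Where the noise level exceeds a large multiple of the rate, it is of constant order
on the whole window. -/
lemma half_le_of_supDist_le {θ₁ θ₂ h σmax r cr : ℝ} {σ : Cov d → ℝ} (hσ : HolderOnCube θ₁ θ₂ σ)
    (hθ₁ : 0 ≤ θ₁) (hθ₂ : 0 < θ₂) (hh : 0 ≤ h) (hσmax : 0 < σmax) (hr : 0 < r)
    (hbias : σmax * θ₁ * h ^ θ₂ ≤ r ^ 2) (hcr : 2 * √d ^ θ₂ + 1 ≤ cr) {x : Cov d}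
    (hx : x ∈ cube d) (hlow : cr * r ≤ σ x) (hup : σ x ≤ σmax) :
    ∀ x' ∈ cube d, supDist x' x ≤ h → σ x / 2 ≤ σ x' := by
  intro x' hx' hxx'
  set K : ℝ := √d ^ θ₂
  have hK : 0 ≤ K := by positivity
  have hcr1 : 1 ≤ cr := by linarith
  have hnorm : ‖x - x'‖ ≤ √d * h := norm_le_sqrt_mul hh fun j => by
    simpa [abs_sub_comm] using (supDist_le_iff hh).1 hxx' j
  have hhol : |σ x - σ x'| ≤ θ₁ * (K * h ^ θ₂) := by
    refine (hσ x hx x' hx').trans ?_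
    rw [← Real.mul_rpow (Real.sqrt_nonneg _) hh]
    gcongr
  have hcr2 : 2 * K ≤ cr ^ 2 := by nlinarith
  have hσpos : 0 < σ x := lt_of_lt_of_le (by positivity) hlow
  -- The factor `σmax` brings in `hbias`; it is cancelled afterwards, using `σ x ^ 2 ≤ σmax * σ x`.
  have hmain : σmax * (2 * (θ₁ * (K * h ^ θ₂))) ≤ σmax * σ x := by
    calc σmax * (2 * (θ₁ * (K * h ^ θ₂))) = 2 * K * (σmax * θ₁ * h ^ θ₂) := by ring
      _ ≤ cr ^ 2 * r ^ 2 := by gcongr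
      _ = (cr * r) ^ 2 := by ring
      _ ≤ σ x ^ 2 := by gcongr
      _ ≤ σmax * σ x := by rw [sq]; gcongr
  have := le_of_mul_le_mul_left hmain hσmax
  linarith [(abs_le.1 hhol).2]

lemma lintegral_risk_eq {Ω : Type*} [MeasurableSpace Ω] (P : Measure Ω) {a : ℝ} (ha : 0 ≤ a)
    (N : Ω → ℕ) :
    ∫⁻ ω, ENNReal.ofReal (a / max 1 (N ω : ℝ)) ∂P
      = ENNReal.ofReal a * ∫⁻ ω, ENNReal.ofReal (1 / max 1 (N ω : ℝ)) ∂P := by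
  rw [← lintegral_const_mul' _ _ ENNReal.ofReal_ne_top]
  simp_rw [← ENNReal.ofReal_mul ha, mul_one_div]

end Retrieval

/-! ### Low-noise and high-noise regions combined. -/

theorem lemma3
    (d : ℕ) (hd : 1 ≤ d)
    -- fixed constants: pilot fraction, bandwidth exponent, constant in the low-noise condition
    (γ : ℝ) (hγ : 0 < γ) (hγ1 : γ < 1) (c₀ : ℝ) (hc₀ : 0 ≤ c₀) (c : ℝ) (hc : 0 < c) (hc1 : c < 1)
    -- bounds on the density ratio and on the covariance, noise bounds, smoothness orders
    (B : ℝ) (hB : 0 < B) (lam₀ : ℝ) (hlam₀ : 0 < lam₀) (σmax : ℝ) (hσmax : 0 < σmax) (κ : ℝ≥0)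
    (θstar₂ : ℝ) (hθstar₂ : 0 < θstar₂) (hθstar₂' : θstar₂ ≤ 1) (θ₂ : ℝ) (hθ₂ : 0 < θ₂) :
    ∃ cr₀ : ℝ, 0 < cr₀ ∧ ∀ cr : ℝ, cr₀ ≤ cr → ∃ C : ℝ, 0 < C ∧
      ∀ (n N : ℕ), 2 ≤ n → n ≤ N →
      ∀ (θstar₁ θ₁ : ℝ) (f σ q : Retrieval.Cov d → ℝ) (β : Retrieval.Cov d)
        (Q : Kernel (Retrieval.Cov d) ℝ), IsMarkovKernel Q →
      Retrieval.SmoothRegression θstar₁ θstar₂ f →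
      Retrieval.NoiseCondition σmax θ₁ θ₂ κ σ Q →
      Retrieval.DensityRatioCondition B lam₀ σ q β →
      ∀ h : ℝ, h = (n : ℝ) ^ (-c₀) →
      (volume (Retrieval.lowNoise σ
          (cr * Retrieval.rateTilde d n σmax θ₁ θ₂ θstar₂ h))).toReal
        ≤ c * min (Retrieval.sigmaBar σ ^ 2
              / (Retrieval.rateTilde d n σmax θ₁ θ₂ θstar₂ h ^ 2 * n * h ^ d))
            (1 / Real.sqrt (Real.log n)) →
      ∀ (Ω : Type*) [MeasurableSpace Ω] (P : Measure Ω) [IsProbabilityMeasure P]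
        (R : Retrieval.Run Ω d n (Retrieval.pilotSize γ n) N),
      Retrieval.IsRetrievalRun P f q Q R →
      ∫⁻ x in Retrieval.cube d, ∫⁻ ω,
          ENNReal.ofReal ((σ x ^ 2 + θ₁ * h ^ θ₂) / max 1 (R.localCount h x ω : ℝ)) ∂P
        ≤ ENNReal.ofReal (C * (Retrieval.sigmaBar σ ^ 2 / (n * h ^ d))) := by
  open Retrieval in
  -- The threshold is the one in `half_le_of_supDist_le`. The two summands of `C` come from the
  -- low-noise and high-noise regions; `24` is the `12` of the budget bound times `2` for `σ x / 2`.
  refine ⟨2 * √d ^ θ₂ + 1, by positivity, fun cr hcr =>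
    ⟨(cr ^ 2 + 1 / σmax) + 24 * (1 + 1 / σmax) / (γ * Real.exp (-(√d * B))), by positivity, ?_⟩⟩
  intro n N hn hnN θstar₁ θ₁ f σ q β Q _ _ hnoise hq h hh hlow Ω _ P _ R hR
  have hcr1 : 1 ≤ cr := le_trans (le_add_of_nonneg_left (by positivity)) hcr
  have hn' : (0 : ℝ) < n := by positivity
  have hh0 : 0 < h := hh ▸ Real.rpow_pos_of_pos hn' _
  have hh1 : h ≤ 1 := hh ▸ Real.rpow_le_one_of_one_le_of_nonpos
    (by exact_mod_cast (by omega : 1 ≤ n)) (by linarith)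
  have hθ₁ := hnoise.theta_nonneg
  have hr : 0 < rateTilde d n σmax θ₁ θ₂ θstar₂ h := rateTilde_pos hn
  have hbias : σmax * θ₁ * h ^ θ₂ ≤ rateTilde d n σmax θ₁ θ₂ θstar₂ h ^ 2 :=
    mul_rpow_le_rateTilde_sq hn
  set r := rateTilde d n σmax θ₁ θ₂ θstar₂ h
  set A : ℝ := θ₁ * h ^ θ₂ with hA_def
  have hA0 : 0 ≤ A := by positivity
  have hAr : A ≤ r ^ 2 / σmax := by
    rw [le_div_iff₀ hσmax]; linarith
  have hI := hq.integral_pos hnoise.sigma_nonneg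
  rw [sigmaBar_eq] at hlow ⊢
  set I : ℝ := ∫ z in cube d, σ z with hI_def
  set a : ℝ := Real.exp (-(√d * B))
  have ha : 0 < a := Real.exp_pos _
  set L := lowNoise σ (cr * r)
  have hσ_le : ∀ x ∈ cube d, σ x ≤ σmax := fun x hx => by
    nlinarith [hnoise.sigma_le x hx, hnoise.sigma_nonneg x hx]
  have hcont := hnoise.holder.continuousOn hθ₂
  have hσint : IntegrableOn σ (cube d) := hcont.integrableOn_compact isCompact_cube
  -- Measurability of `F` is never needed: the integral comparisons below require only measurable
  -- sets.
  set F : Cov d → ℝ≥0∞ := fun x =>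
    ∫⁻ ω, ENNReal.ofReal ((σ x ^ 2 + A) / max 1 (R.localCount h x ω : ℝ)) ∂P
  have hF : ∀ x, F x = ENNReal.ofReal (σ x ^ 2 + A)
      * ∫⁻ ω, ENNReal.ofReal (1 / max 1 (R.localCount h x ω : ℝ)) ∂P := fun x =>
    lintegral_risk_eq P (by positivity) (fun ω => R.localCount h x ω)
  -- Continuity of `σ` is known only on the cube, so `L` is obtained as a closed subset of it.
  have hLmeas : MeasurableSet L := by
    have : L = cube d ∩ σ ⁻¹' Set.Iic (cr * r) := rfl
    rw [this]
    exact (hcont.preimage_isClosed_of_isClosed isCompact_cube.isClosed isClosed_Iic).measurableSet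
  have hLsub : L ⊆ cube d := fun x hx => hx.1
  have hF_low : ∫⁻ x in L, F x ≤ ENNReal.ofReal ((cr ^ 2 + 1 / σmax) * (I ^ 2 / (n * h ^ d))) := by
    have hb : ∀ x ∈ L, F x ≤ ENNReal.ofReal ((cr ^ 2 + 1 / σmax) * r ^ 2) := fun x hx => by
      rw [hF]
      refine (mul_le_of_le_one_right' (lintegral_inv_localCount_le_one R h x)).trans
        (ENNReal.ofReal_le_ofReal ?_)
      have : σ x ^ 2 ≤ (cr * r) ^ 2 := pow_le_pow_left₀ (hnoise.sigma_nonneg x hx.1) hx.2 2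
      calc σ x ^ 2 + A ≤ (cr * r) ^ 2 + r ^ 2 / σmax := add_le_add this hAr
        _ = _ := by ring
    refine (setLIntegral_mono' hLmeas hb).trans ?_
    have hfin : volume L ≠ ∞ :=
      ((measure_mono hLsub).trans_lt (by rw [volume_cube]; exact ENNReal.one_lt_top)).ne
    rw [setLIntegral_const, ← ENNReal.ofReal_toReal hfin, ← ENNReal.ofReal_mul (by positivity)]
    refine ENNReal.ofReal_le_ofReal ?_
    have hX : 0 ≤ I ^ 2 / (r ^ 2 * n * h ^ d) := by positivity
    have hvol : (volume L).toReal ≤ I ^ 2 / (r ^ 2 * n * h ^ d) := by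
      refine hlow.trans ((mul_le_mul_of_nonneg_left (min_le_left _ _) hc.le).trans ?_)
      exact mul_le_of_le_one_left hX hc1.le
    calc (cr ^ 2 + 1 / σmax) * r ^ 2 * (volume L).toReal
        ≤ (cr ^ 2 + 1 / σmax) * r ^ 2 * (I ^ 2 / (r ^ 2 * n * h ^ d)) := by gcongr
      _ = _ := by field_simp
  have hF_high : ∫⁻ x in cube d \ L, F x
      ≤ ENNReal.ofReal (24 * (1 + 1 / σmax) / (γ * a) * (I ^ 2 / (n * h ^ d))) := by
    -- The numerator is of order `σ x ^ 2` and the window mass of order `σ x / I`. One factor `σ x`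
    -- survives, and its integral supplies the second `I`.
    set D : ℝ := 24 * (1 + 1 / σmax) / (γ * a) * (I / (n * h ^ d))
    have hD : 0 ≤ D := by positivity
    have hb : ∀ x ∈ cube d \ L, F x ≤ ENNReal.ofReal (D * σ x) := by
      rintro x ⟨hx, hxL⟩
      have hgt : cr * r < σ x := lt_of_not_ge fun hle => hxL ⟨hx, hle⟩
      have hσx : 0 < σ x := lt_of_le_of_lt (by positivity) hgt
      have hwin := half_le_of_supDist_le hnoise.holder hθ₁ hθ₂ hh0.le hσmax hr hbias hcr hx
        hgt.le (hσ_le x hx)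
      have hpA : σ x / 2 * a / I * h ^ d ≤ (densityLaw q).real {x' | supDist x' x ≤ h} :=
        hq.le_measureReal_window hnoise.sigma_nonneg hx hh0.le hh1 (by positivity) hwin
      have := hq.isProbabilityMeasure
      rw [hF]
      refine (mul_le_mul_right (hR.lintegral_inv_localCount_le_budget hγ (by omega) h x
        (by positivity) (hpA.trans measureReal_le_one) hpA) _).trans ?_
      rw [← ENNReal.ofReal_mul (by positivity)]
      refine ENNReal.ofReal_le_ofReal ?_
      have hrσ : r ^ 2 ≤ σ x ^ 2 := by
        have : r ≤ σ x := (le_mul_of_one_le_left hr.le hcr1).trans hgt.le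
        gcongr
      have hAσ : σ x ^ 2 + A ≤ (1 + 1 / σmax) * σ x ^ 2 := by
        have : r ^ 2 / σmax ≤ σ x ^ 2 / σmax := by gcongr
        calc σ x ^ 2 + A ≤ σ x ^ 2 + σ x ^ 2 / σmax := by linarith
          _ = _ := by ring
      refine (mul_le_mul_of_nonneg_right hAσ (by positivity)).trans_eq ?_
      simp only [D]
      field_simp
      norm_num
    refine (setLIntegral_mono' (measurableSet_cube.diff hLmeas) hb).trans
      ((lintegral_mono_set Set.sdiff_subset).trans_eq ?_)
    rw [← ofReal_integral_eq_lintegral_ofReal (hσint.const_mul D)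
      ((ae_restrict_iff' measurableSet_cube).2 (ae_of_all _ fun x hx =>
        mul_nonneg hD (hnoise.sigma_nonneg x hx))), integral_const_mul, ← hI_def]
    congr 1
    simp only [D]
    ring
  calc ∫⁻ x in cube d, F x = ∫⁻ x in L ∪ cube d \ L, F x := by rw [Set.union_sdiff_cancel hLsub]
    _ ≤ (∫⁻ x in L, F x) + ∫⁻ x in cube d \ L, F x := lintegral_union_le _ _ _
    _ ≤ _ := add_le_add hF_low hF_high
    _ = _ := by
      rw [← ENNReal.ofReal_add (by positivity) (by positivity), ← add_mul]
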